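/- Let $\mu>0$ and let $k$ be an even natural number. There is a constant $C=C(\mu,k)>0$ such that the following holds for every $0<\varepsilon<1$, every real $e\ge 0$ and every integer $p\ge 1$. Put $n=\lfloor p^{1-\varepsilon}\rfloor$. Let $\mathcal H$ be a complex Hilbert space of dimension $p$, let $\mathfrak X$ be a finite non-empty set, and for each $x\in\mathfrak X$ let $B_x=\{b_x^1,\dots,b_x^p\}$ be an orthonormal basis of $\mathcal H$, such that $|\langle b_x^i,b_y^j\rangle|\le \mu/\sqrt p$ for all $x\ne y$ in $\mathfrak X$ and all $i,j$. Let $\mathfrak D=\bigsqcup_{x\in\mathfrak X}B_x$ be the disjoint union of these bases (a $\mu$-coherent dictionary). Choose an injective map $S:\{1,\dots,n\}\to\mathfrak D$ uniformly at random, and let $\mathbf G=(\langle S(i),S(j)\rangle)_{1\le i,j\le n}$ be the Gram matrix of the chosen atoms. Then, with $\|\cdot\|$ the operator norm on $\mathbb C^n$ with its Euclidean norm, $$\Pr\left(\|\mathbf G-I_n\|\ge (n/p)^{1/(2+e)}\right)\le C\,(n/p)^{ek/(2+e)}\,n .$$ In particular, for any fixed $\varepsilon$, $e$, $k$ and any sequence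 of $\mu$-coherent dictionaries indexed by $p\to\infty$, this probability is $O\left((n/p)^{ek/(2+e)}n\right)$; the bound tends to $0$ when $ek$ is sufficiently large in terms of $\varepsilon$ and $e$. -/

import Mathlib

/-- A family `(B x)` of orthonormal bases of a `p`-dimensional complex Hilbert space is (pairwise)
`μ`-coherent if `|⟨b, b'⟩| ≤ μ / √p` whenever `b`, `b'` belong to bases with different labels. -/
def IsCoherentFamily {H X : Type*} [NormedAddCommGroup H] [InnerProductSpace ℂ H] {p : ℕ}
    (μ : ℝ) (B : X → OrthonormalBasis (Fin p) ℂ H) : Prop :=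
  ∀ x y : X, x ≠ y → ∀ i j : Fin p, ‖inner ℂ (B x i) (B y j)‖ ≤ μ / √(p : ℝ)

/-- The Gram matrix `(⟨S i, S j⟩)` of the atoms selected by `S`. The dictionary is the disjoint
union of the bases `B x`, so its atoms are labelled by the pairs `(x, i)`. -/
noncomputable def gramMatrix {H X : Type*} [NormedAddCommGroup H] [InnerProductSpace ℂ H]
    {p n : ℕ} (B : X → OrthonormalBasis (Fin p) ℂ H) (S : Fin n ↪ X × Fin p) :
    Matrix (Fin n) (Fin n) ℂ :=
  Matrix.gram ℂ (fun i => B (S i).1 (S i).2)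

/-- The operator norm of a complex matrix with respect to the Euclidean norm on `ℂⁿ`. -/
noncomputable def matrixOpNorm {n : ℕ} (M : Matrix (Fin n) (Fin n) ℂ) : ℝ :=
  ‖Matrix.toEuclideanCLM (n := Fin n) (𝕜 := ℂ) M‖

/-- The probability of the event `E` under the uniform distribution on a finite set `Ω`. -/
noncomputable def uniformProb {Ω : Type*} (E : Set Ω) : ℝ :=
  (E.ncard : ℝ) / (Nat.card Ω : ℝ)

/-! The proof is the moment method. With `A = G - 1` and `K = 2 ^ k`, the `2K`-th power of the norm
of `A` is at most `tr A ^ (2K)`, a sum over closed words `w` of length `2K` in `n` letters. A random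
injection composed with a random permutation of the dictionary is again uniform, so it suffices to
average each word over permutations.

The heart is `norm_sum_perm_cycleProd_le`: a word with `v` distinct letters has mean `O(p ^ (1 -
v))`. A union of `N` orthonormal bases is a tight frame, `∑ y, g a y * g y b = N * g a b`, so
averaging over a letter that occurs once gains a factor `1 / p`. Equal neighbours merge because
atoms are unit vectors. If neither reduction applies, every letter occurs at least twice, and
coherence alone gives `p ^ (-v)`.

About `n ^ v` words have `v` letters, so the `2K`-th moment is `O(n * (n / p) ^ K)`, and Markov's
inequality concludes. -/

open scoped Nat

/-! ### Cyclic words and their rotations -/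

/-- The product of the values of `g` along the walk that goes from `a` through `l` to `b`. -/
def walkProd {α : Type*} (g : α → α → ℂ) : α → List α → α → ℂ
  | a, [], b => g a b
  | a, x :: l, b => g a x * walkProd g x l b

/-- The product of the values of `g` along the closed walk through the vertices in `l`. -/
def cycleProd {α : Type*} (g : α → α → ℂ) : List α → ℂ
  | [] => 1
  | a :: l => walkProd g a l a

theorem walkProd_append {α : Type*} (g : α → α → ℂ) (a b x : α) (l₁ l₂ : List α) :
    walkProd g a (l₁ ++ x :: l₂) b = walkProd g a l₁ x * walkProd g x l₂ b := by
  induction l₁ generalizing a with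
  | nil => rfl
  | cons y l ih => simp [walkProd, ih, mul_assoc]

theorem cycleProd_append_comm {α : Type*} (g : α → α → ℂ) (l₁ l₂ : List α) :
    cycleProd g (l₁ ++ l₂) = cycleProd g (l₂ ++ l₁) := by
  cases l₁ with
  | nil => simp
  | cons a s =>
    cases l₂ with
    | nil => simp
    | cons b t => simp [cycleProd, walkProd_append, mul_comm]

theorem walkProd_map {α β : Type*} (g : β → β → ℂ) (f : α → β) (a b : α) (l : List α) :
    walkProd g (f a) (l.map f) (f b) = walkProd (fun x y => g (f x) (f y)) a l b := by
  induction l generalizing a with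
  | nil => rfl
  | cons y l ih => simp [walkProd, ih]

theorem cycleProd_map {α β : Type*} (g : β → β → ℂ) (f : α → β) (l : List α) :
    cycleProd g (l.map f) = cycleProd (fun x y => g (f x) (f y)) l := by
  cases l with
  | nil => rfl
  | cons a l => exact walkProd_map g f a a l

theorem norm_walkProd_le {α : Type*} {g : α → α → ℂ} {c : ℝ}
    (hg : ∀ a b, ‖g a b‖ ≤ c) (a b : α) (l : List α) :
    ‖walkProd g a l b‖ ≤ c ^ (l.length + 1) := by
  have hc : 0 ≤ c := (norm_nonneg _).trans (hg a b)
  induction l generalizing a with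
  | nil => simpa [walkProd] using hg a b
  | cons y l ih =>
    rw [walkProd, norm_mul, List.length_cons, pow_succ']
    exact mul_le_mul (hg _ _) (ih _) (norm_nonneg _) hc

theorem norm_cycleProd_le {α : Type*} {g : α → α → ℂ} {c : ℝ}
    (hg : ∀ a b, ‖g a b‖ ≤ c) (l : List α) : ‖cycleProd g l‖ ≤ c ^ l.length := by
  cases l with
  | nil => simp [cycleProd]
  | cons a l => exact norm_walkProd_le hg a a l

/-- The off-diagonal part of `g`. -/
def offDiag {α : Type*} [DecidableEq α] (g : α → α → ℂ) (a b : α) : ℂ :=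
  if a = b then 0 else g a b

theorem norm_offDiag_le {α : Type*} [DecidableEq α] {g : α → α → ℂ} {c : ℝ} (hc : 0 ≤ c)
    (hg : ∀ a b, a ≠ b → ‖g a b‖ ≤ c) (a b : α) : ‖offDiag g a b‖ ≤ c := by
  unfold offDiag
  split_ifs with h
  · simpa using hc
  · exact hg a b h

theorem walkProd_offDiag_of_isChain {α : Type*} [DecidableEq α] (g : α → α → ℂ) (a b : α)
    (l : List α) (h : (a :: (l ++ [b])).IsChain (· ≠ ·)) :
    walkProd (offDiag g) a l b = walkProd g a l b := by
  induction l generalizing a with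
  | nil => simp_all [walkProd, offDiag]
  | cons y l ih =>
    rw [List.cons_append, List.isChain_cons_cons] at h
    rw [walkProd, walkProd, ih y h.2, offDiag, if_neg h.1]

theorem walkProd_offDiag_of_not_isChain {α : Type*} [DecidableEq α] (g : α → α → ℂ) (a b : α)
    (l : List α) (h : ¬ (a :: (l ++ [b])).IsChain (· ≠ ·)) :
    walkProd (offDiag g) a l b = 0 := by
  induction l generalizing a with
  | nil => simp_all [walkProd, offDiag]
  | cons y l ih =>
    rw [List.cons_append, List.isChain_cons_cons, not_and_or] at h
    rcases h with h | h
    · simp [walkProd, offDiag, not_not.mp h]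
    · rw [walkProd, ih y h, mul_zero]

/-- `offDiag` either does not change a cyclic product or kills it, depending on the word only. -/
theorem cycleProd_offDiag_dichotomy {α : Type*} [DecidableEq α] (l : List α) :
    (∀ g : α → α → ℂ, cycleProd (offDiag g) l = cycleProd g l) ∨
      ∀ g : α → α → ℂ, cycleProd (offDiag g) l = 0 := by
  cases l with
  | nil => exact .inl fun _ => rfl
  | cons a l =>
    by_cases h : (a :: (l ++ [a])).IsChain (· ≠ ·)
    · exact .inl fun g => walkProd_offDiag_of_isChain g a a l h
    · exact .inr fun g => walkProd_offDiag_of_not_isChain g a a l h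

/-- A cyclic word with at least two letters has, up to rotation, two equal consecutive letters,
or no two cyclically consecutive letters of it agree. -/
theorem exists_rotation_cons_cons {α : Type*} [DecidableEq α] {l : List α} {a b : α}
    (ha : a ∈ l) (hb : b ∈ l) (hab : a ≠ b) :
    (∃ (c : α) (t : List α), l.Perm (c :: c :: t) ∧
      ∀ g : α → α → ℂ, cycleProd g l = cycleProd g (c :: c :: t)) ∨
    ∀ g : α → α → ℂ, cycleProd (offDiag g) l = cycleProd g l := by
  cases l with
  | nil => simp at ha
  | cons x l =>
    by_cases h : (x :: (l ++ [x])).IsChain (· ≠ ·)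
    · exact .inr fun g => walkProd_offDiag_of_isChain g x x l h
    · left
      rw [← List.cons_append] at h
      -- If the word read linearly has no equal neighbours, the repetition sits at the wrap from its
      -- last letter to its first.
      by_cases h' : (x :: l).IsChain (· ≠ ·)
      · obtain ⟨s, y, hs⟩ : ∃ s y, l = s ++ [y] := by
          rcases List.eq_nil_or_concat l with rfl | ⟨s, y, rfl⟩
          · simp at ha hb; exact absurd (ha.trans hb.symm) hab
          · exact ⟨s, y, by simp⟩
        subst hs
        have hy : y = x := by
          by_contra hyx
          apply h
          rw [List.isChain_append]
          refine ⟨h', by simp, ?_⟩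
          intro u hu v hv
          simp at hu hv
          rcases hu; rcases hv; simpa using hyx
        subst hy
        refine ⟨y, s, ?_, fun g => ?_⟩
        · exact List.perm_append_comm (l₁ := y :: s)
        · exact cycleProd_append_comm g (y :: s) [y]
      · obtain ⟨i, hi, hne⟩ := List.exists_not_getElem_of_not_isChain h'
        rw [not_not] at hne
        have e : x :: l = (x :: l).take i ++ (x :: l)[i] :: (x :: l)[i] :: (x :: l).drop (i + 2) := by
          conv_rhs => enter [2, 2]; rw [hne]
          rw [← List.drop_eq_getElem_cons, ← List.drop_eq_getElem_cons, List.take_append_drop]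
        generalize (x :: l)[i] = c at e
        generalize (x :: l).take i = u at e
        generalize (x :: l).drop (i + 2) = v at e
        rw [e]
        exact ⟨c, v ++ u, List.perm_append_comm, fun g => cycleProd_append_comm g _ _⟩

/-- A letter occurring in a cyclic word, not on its own, can be rotated to the second place. -/
theorem exists_rotation_second {α : Type*} {l : List α} {d b : α} (hd : d ∈ l) (hb : b ∈ l)
    (hdb : d ≠ b) :
    ∃ (a : α) (t : List α), l.Perm (a :: d :: t) ∧
      ∀ g : α → α → ℂ, cycleProd g l = cycleProd g (a :: d :: t) := by
  obtain ⟨u, v, rfl⟩ := List.append_of_mem hd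
  have hne : v ++ u ≠ [] := by
    intro h
    simp at h
    simp [h.1, h.2] at hb
    exact hdb hb.symm
  rcases List.eq_nil_or_concat (v ++ u) with h | ⟨s, y, h⟩
  · exact absurd h hne
  · rw [List.concat_eq_append] at h
    refine ⟨y, s, ?_, fun g => ?_⟩
    · refine (List.perm_append_comm (l₁ := u)).trans ?_
      rw [List.cons_append, h]
      exact List.perm_append_comm (l₁ := d :: s)
    · rw [cycleProd_append_comm, List.cons_append, h]
      exact cycleProd_append_comm g (d :: s) [y]

/-! ### Averages of cyclic words over permutations of the dictionary -/

theorem sum_cycleProd_second {α : Type*} [Fintype α] {g : α → α → ℂ} {N : ℂ}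
    (hg : ∀ a b, ∑ y, g a y * g y b = N * g a b) (a : α) (t : List α) :
    ∑ y, cycleProd g (a :: y :: t) = N * cycleProd g (a :: t) := by
  cases t with
  | nil => simpa [cycleProd, walkProd] using hg a a
  | cons b t =>
    simp only [cycleProd, walkProd, ← mul_assoc, ← hg, Finset.sum_mul]

theorem two_mul_card_toFinset_le_length {α : Type*} [DecidableEq α] {l : List α}
    (h : ∀ a ∈ l, l.count a ≠ 1) : 2 * l.toFinset.card ≤ l.length := by
  rw [← List.sum_toFinset_count_eq_length, mul_comm]
  refine Finset.card_nsmul_le_sum _ _ 2 fun a ha => ?_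
  have := h a (List.mem_toFinset.mp ha)
  have := List.count_pos_iff.mpr (List.mem_toFinset.mp ha)
  omega

theorem map_perm_mul_swap_eq {D : Type*} [DecidableEq D] {d y : D} {l : List D}
    (σ : Equiv.Perm D) (hd : d ∉ l) (hy : y ∉ l) :
    l.map (σ * Equiv.swap d y) = l.map σ := by
  refine List.map_congr_left fun x hx => ?_
  rw [Equiv.Perm.mul_apply, Equiv.swap_apply_of_ne_of_ne]
  · rintro rfl; exact hd hx
  · rintro rfl; exact hy hx

/-- Averaging a letter that occurs only once over the letters not occurring elsewhere. -/
theorem card_mul_sum_cycleProd_eq {D : Type*} [Fintype D] [DecidableEq D] {g : D → D → ℂ} {N : ℂ}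
    (hg : ∀ a b, ∑ y, g a y * g y b = N * g a b) {a d : D} {t : List D} (hd : d ∉ a :: t) :
    (((a :: t).toFinsetᶜ.card : ℕ) : ℂ) *
        ∑ σ : Equiv.Perm D, cycleProd g ((a :: d :: t).map σ) =
      N * ∑ σ : Equiv.Perm D, cycleProd g ((a :: t).map σ) -
        ∑ c ∈ (a :: t).toFinset, ∑ σ : Equiv.Perm D, cycleProd g ((a :: c :: t).map σ) := by
  -- All letters outside `a :: t` are interchangeable: composing `σ` with the transposition of `d`
  -- and `y` moves no letter of `a :: t`.
  have h1 : ∀ y ∈ (a :: t).toFinsetᶜ,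
      ∑ σ : Equiv.Perm D, cycleProd g ((a :: y :: t).map σ) =
        ∑ σ : Equiv.Perm D, cycleProd g ((a :: d :: t).map σ) := by
    intro y hy
    have hy' : y ∉ a :: t := by simpa using hy
    refine (Fintype.sum_equiv (Equiv.mulRight (Equiv.swap d y)) _ _ fun σ => ?_)
    have h := map_perm_mul_swap_eq σ hd hy'
    rw [List.map_cons, List.map_cons, List.cons.injEq] at h
    simp only [Equiv.coe_mulRight, List.map_cons, h.1, h.2, Equiv.Perm.mul_apply σ,
      Equiv.swap_apply_left]
  have h2 : ∑ y, ∑ σ : Equiv.Perm D, cycleProd g ((a :: y :: t).map σ) =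
      N * ∑ σ : Equiv.Perm D, cycleProd g ((a :: t).map σ) := by
    rw [Finset.sum_comm, Finset.mul_sum]
    refine Finset.sum_congr rfl fun σ _ => ?_
    rw [List.map_cons, ← sum_cycleProd_second hg]
    exact Fintype.sum_equiv σ _ _ fun y => by simp
  rw [← h2, ← Finset.sum_add_sum_compl (a :: t).toFinset, add_sub_cancel_left,
    Finset.sum_congr rfl h1, Finset.sum_const, nsmul_eq_mul]

theorem norm_sum_perm_le {D : Type*} [Fintype D] [DecidableEq D] (f : Equiv.Perm D → ℂ) {c : ℝ}
    (hf : ∀ σ, ‖f σ‖ ≤ c) : ‖∑ σ, f σ‖ ≤ Fintype.card (Equiv.Perm D) * c := by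
  refine (norm_sum_le _ _).trans ?_
  refine (Finset.sum_le_card_nsmul _ _ c fun σ _ => hf σ).trans ?_
  rw [nsmul_eq_mul, Finset.card_univ]

/-- If the cyclic words obtained by deleting or by replacing a letter `d` that occurs only once
have small expectation, then the original word gains a factor `1 / p`. -/
theorem norm_sum_perm_second_le {D : Type*} [Fintype D] [DecidableEq D] {g : D → D → ℂ}
    {N p : ℕ} (hN : 1 ≤ N) (hcard : Fintype.card D = N * p)
    (hmul : ∀ a b, ∑ y, g a y * g y b = N * g a b) {a d : D} {t : List D} (hd : d ∉ a :: t)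
    {v : ℕ} (hv : (a :: t).toFinset.card = v) {Q : ℝ} (hQ : 0 ≤ Q)
    (hdel : ‖∑ σ : Equiv.Perm D, cycleProd g ((a :: t).map σ)‖ * (p : ℝ) ^ v ≤ Q)
    (hrep : ∀ c ∈ (a :: t).toFinset,
      ‖∑ σ : Equiv.Perm D, cycleProd g ((a :: c :: t).map σ)‖ * (p : ℝ) ^ v ≤ Q) :
    ‖∑ σ : Equiv.Perm D, cycleProd g ((a :: d :: t).map σ)‖ * (p : ℝ) ^ (v + 1) ≤
      ((v : ℝ) + 1) ^ 2 * Q := by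
  have hbase := card_mul_sum_cycleProd_eq (N := (N : ℂ)) hmul hd
  have hv1 : 1 ≤ v := by
    rw [← hv]; exact Finset.card_pos.mpr ⟨a, by simp⟩
  have hvm : v + 1 ≤ N * p := by
    have h := Finset.card_le_univ (insert d (a :: t).toFinset)
    rwa [Finset.card_insert_of_notMem (by simpa using hd), hv, hcard] at h
  have hYcard : (a :: t).toFinsetᶜ.card = N * p - v := by rw [Finset.card_compl, hcard, hv]
  obtain ⟨E₂, hE₂⟩ : ∃ f : D → ℂ, ∀ c,
      ∑ σ : Equiv.Perm D, cycleProd g ((a :: c :: t).map σ) = f c := ⟨_, fun _ => rfl⟩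
  simp only [hE₂] at hbase hrep ⊢
  generalize (a :: t).toFinset = A at *
  generalize E₂ d = E at *
  generalize (∑ σ : Equiv.Perm D, cycleProd g ((a :: t).map σ)) = E₁ at *
  have hY0 : (0 : ℝ) < Aᶜ.card := by
    rw [hYcard]; exact_mod_cast (by omega : 0 < N * p - v)
  -- From `N * p ≥ v + 1`, the number `N * p - v` of fresh letters is at least `N * p / (v + 1)`.
  -- With `N + v ≤ N * (v + 1)` the loss is `(v + 1) ^ 2`, which accumulates to a squared factorial.
  have hYbound : ((N : ℝ) + v) * p ≤ Aᶜ.card * ((v : ℝ) + 1) ^ 2 := by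
    rw [hYcard, Nat.cast_sub (by omega)]
    have h3 : (v : ℝ) + 1 ≤ N * p := by exact_mod_cast hvm
    have h4 : (1 : ℝ) ≤ v := by exact_mod_cast hv1
    have h5 : (1 : ℝ) ≤ N := by exact_mod_cast hN
    have h6 : (N : ℝ) * p ≤ (N * p - v) * (v + 1) := by nlinarith
    have h7 : (N : ℝ) + v ≤ N * (v + 1) := by nlinarith
    push_cast
    calc ((N : ℝ) + v) * p ≤ N * (v + 1) * p := by gcongr
      _ = N * p * (v + 1) := by ring
      _ ≤ (N * p - v) * (v + 1) * (v + 1) := by gcongr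
      _ = _ := by ring
  have hEn : (Aᶜ.card : ℝ) * ‖E‖ * (p : ℝ) ^ v ≤ (N + v) * Q := by
    have h : (Aᶜ.card : ℝ) * ‖E‖ = ‖(Aᶜ.card : ℂ) * E‖ := by simp
    rw [h, hbase]
    calc _ ≤ (‖(N : ℂ) * E₁‖ + ∑ c ∈ A, ‖E₂ c‖) * (p : ℝ) ^ v := by
          gcongr
          exact (norm_sub_le _ _).trans (by gcongr; exact norm_sum_le _ _)
      _ = N * (‖E₁‖ * (p : ℝ) ^ v) + ∑ c ∈ A, ‖E₂ c‖ * (p : ℝ) ^ v := by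
          rw [norm_mul, add_mul, Finset.sum_mul, mul_assoc]; simp
      _ ≤ N * Q + ∑ c ∈ A, Q := by
          gcongr with c hc
          exact hrep c hc
      _ = _ := by rw [Finset.sum_const, nsmul_eq_mul, hv]; ring
  refine le_of_mul_le_mul_left ?_ hY0
  calc (Aᶜ.card : ℝ) * (‖E‖ * (p : ℝ) ^ (v + 1))
      = (Aᶜ.card : ℝ) * ‖E‖ * (p : ℝ) ^ v * p := by ring
    _ ≤ (N + v) * Q * p := by gcongr
    _ = (N + v) * p * Q := by ring
    _ ≤ Aᶜ.card * ((v : ℝ) + 1) ^ 2 * Q := by gcongr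
    _ = _ := by ring

/-- Bound for the expectation of a cyclic product of Gram matrix entries of randomly permuted
atoms, in terms of the number of distinct letters of the word. -/
theorem norm_sum_perm_cycleProd_le {D : Type*} [Fintype D] [DecidableEq D] {g : D → D → ℂ}
    {N p : ℕ} {M : ℝ} (hN : 1 ≤ N) (hp : 1 ≤ p) (hcard : Fintype.card D = N * p) (hM : 1 ≤ M)
    (h1 : ∀ a, g a a = 1) (hle : ∀ a b, ‖g a b‖ ≤ 1)
    (hoff : ∀ a b, a ≠ b → ‖g a b‖ ≤ M / √(p : ℝ))
    (hmul : ∀ a b, ∑ y, g a y * g y b = N * g a b) (l : List D) :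
    ‖∑ σ : Equiv.Perm D, cycleProd g (l.map σ)‖ * (p : ℝ) ^ l.toFinset.card ≤
      Fintype.card (Equiv.Perm D) * (M ^ l.length * (l.toFinset.card ! : ℝ) ^ 2 * p) := by
  have hp1 : (1 : ℝ) ≤ p := by exact_mod_cast hp
  have hM0 : 0 ≤ M := by linarith
  -- Deleting a single letter lowers both summands, replacing it by another letter of the word
  -- lowers the first, and merging equal neighbours lowers the second.
  induction hs : l.toFinset.card + l.length using Nat.strong_induction_on generalizing l with
  | _ s ih =>
  subst hs
  have hfac : (1 : ℝ) ≤ (l.toFinset.card ! : ℝ) ^ 2 :=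
    one_le_pow₀ (by exact_mod_cast Nat.one_le_iff_ne_zero.mpr (Nat.factorial_ne_zero _))
  have hMl : 1 ≤ M ^ l.length := one_le_pow₀ hM
  rcases Nat.lt_or_ge 1 l.toFinset.card with hv | hv
  swap
  -- With at most one distinct letter, the extra factor `p` in the bound absorbs `p ^ v`.
  · have hb : ‖∑ σ : Equiv.Perm D, cycleProd g (l.map σ)‖ ≤ Fintype.card (Equiv.Perm D) * 1 :=
      norm_sum_perm_le _ fun σ => (norm_cycleProd_le hle _).trans (by simp)
    have hpp : (p : ℝ) ^ l.toFinset.card ≤ p := by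
      simpa using pow_le_pow_right₀ hp1 hv
    calc _ ≤ (Fintype.card (Equiv.Perm D) * 1 : ℝ) * p := by gcongr
      _ ≤ _ := by
        rw [mul_assoc]
        gcongr
        exact one_le_mul_of_one_le_of_one_le hMl hfac
  obtain ⟨a, ha, b, hb, hab⟩ := Finset.one_lt_card.mp hv
  rw [List.mem_toFinset] at ha hb
  by_cases hcount : ∃ d ∈ l, l.count d = 1
  · obtain ⟨d, hd, hd1⟩ := hcount
    obtain ⟨b', hb', hdb'⟩ : ∃ b' ∈ l, d ≠ b' := by
      by_cases h : d = a
      · exact ⟨b, hb, h ▸ hab⟩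
      · exact ⟨a, ha, h⟩
    obtain ⟨a', t, hperm, hrot⟩ := exists_rotation_second hd hb' hdb'
    have hnot : d ∉ a' :: t := by
      rw [hperm.count_eq, (List.Perm.swap d a' t).count_eq, List.count_cons_self] at hd1
      exact List.count_eq_zero.mp (by omega)
    have hset : l.toFinset = insert d (a' :: t).toFinset := by
      rw [List.toFinset_eq_of_perm _ _ hperm]
      ext x; simp only [List.mem_toFinset, List.mem_cons, Finset.mem_insert]; tauto
    have hcardv : l.toFinset.card = (a' :: t).toFinset.card + 1 := by
      rw [hset, Finset.card_insert_of_notMem (by simpa using hnot)]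
    have hlen : l.length = (a' :: t).length + 1 := by rw [hperm.length_eq]; simp
    have hsum : ∑ σ : Equiv.Perm D, cycleProd g (l.map σ) =
        ∑ σ : Equiv.Perm D, cycleProd g ((a' :: d :: t).map σ) :=
      Finset.sum_congr rfl fun σ _ => by rw [cycleProd_map, cycleProd_map, hrot]
    obtain ⟨v, hvdef⟩ : ∃ v, (a' :: t).toFinset.card = v := ⟨_, rfl⟩
    have hdel := ih _ (by omega) (a' :: t) rfl
    have hrep : ∀ c ∈ (a' :: t).toFinset,
        ‖∑ σ : Equiv.Perm D, cycleProd g ((a' :: c :: t).map σ)‖ * (p : ℝ) ^ v ≤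
          Fintype.card (Equiv.Perm D) * (M ^ l.length * (v ! : ℝ) ^ 2 * p) := by
      intro c hc
      have hc' : (a' :: c :: t).toFinset = (a' :: t).toFinset := by
        rw [List.mem_toFinset, List.mem_cons] at hc
        ext x
        simp only [List.mem_toFinset, List.mem_cons]
        constructor
        · rintro (h | rfl | h) <;> tauto
        · tauto
      have hc'' : (a' :: c :: t).length = l.length := by rw [hlen]; simp
      have := ih _ (by rw [hc', hc'']; omega) (a' :: c :: t) rfl
      rwa [hc', hc'', hvdef] at this
    rw [hvdef] at hdel
    have hfin := norm_sum_perm_second_le hN hcard hmul hnot hvdef (by positivity)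
      (hdel.trans (by rw [hlen]; gcongr; omega)) hrep
    rw [hsum, hcardv, hvdef, Nat.factorial_succ]
    refine hfin.trans_eq ?_
    push_cast
    ring
  · push Not at hcount
    rcases exists_rotation_cons_cons ha hb hab with ⟨c, t, hperm, hrot⟩ | hoffdiag
    · have hset : l.toFinset = (c :: t).toFinset := by
        rw [List.toFinset_eq_of_perm _ _ hperm]; simp
      have hlen : l.length = (c :: t).length + 1 := by rw [hperm.length_eq]; simp
      have hsum : ∑ σ : Equiv.Perm D, cycleProd g (l.map σ) =
          ∑ σ : Equiv.Perm D, cycleProd g ((c :: t).map σ) :=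
        Finset.sum_congr rfl fun σ _ => by
          rw [cycleProd_map, hrot, cycleProd_map]
          simp [cycleProd, walkProd, h1]
      have := ih _ (by rw [hset]; omega) (c :: t) rfl
      rw [hsum, hset]
      refine this.trans ?_
      rw [hlen]
      gcongr
      omega
    -- Every factor is now off-diagonal, hence at most `M / √p`, and the length is at least `2v`.
    · have h2 := two_mul_card_toFinset_le_length hcount
      have hs0 : 0 < √(p : ℝ) := by positivity
      have hs1 : 1 ≤ √(p : ℝ) := Real.one_le_sqrt.mpr hp1
      have hb : ‖∑ σ : Equiv.Perm D, cycleProd g (l.map σ)‖ ≤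
          Fintype.card (Equiv.Perm D) * (M / √(p : ℝ)) ^ l.length := by
        refine norm_sum_perm_le _ fun σ => ?_
        rw [cycleProd_map, ← hoffdiag]
        refine norm_cycleProd_le (norm_offDiag_le (by positivity) fun x y hxy => ?_) l
        exact hoff _ _ (σ.injective.ne hxy)
      calc _ ≤ Fintype.card (Equiv.Perm D) * (M / √(p : ℝ)) ^ l.length *
            (p : ℝ) ^ l.toFinset.card := by gcongr
        _ = Fintype.card (Equiv.Perm D) * (M ^ l.length *
            (√(p : ℝ) ^ (2 * l.toFinset.card) / √(p : ℝ) ^ l.length)) := by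
            rw [pow_mul, Real.sq_sqrt (by positivity), div_pow]; ring
        _ ≤ Fintype.card (Equiv.Perm D) * (M ^ l.length * 1) := by
            gcongr
            rw [div_le_one (by positivity)]
            exact pow_le_pow_right₀ hs1 h2
        _ ≤ _ := by
            rw [mul_assoc (M ^ _)]
            gcongr
            exact one_le_mul_of_one_le_of_one_le hfac hp1

/-! ### Traces of powers, word counting and operator norms -/

theorem pow_succ_apply_eq_sum_walkProd {ι : Type*} [Fintype ι] [DecidableEq ι]
    (A : Matrix ι ι ℂ) (k : ℕ) (i j : ι) :
    (A ^ (k + 1)) i j = ∑ w : Fin k → ι, walkProd A i (List.ofFn w) j := by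
  induction k generalizing i with
  | zero => simp [walkProd]
  | succ k ih =>
    rw [pow_succ', Matrix.mul_apply, ← (Fin.consEquiv fun _ => ι).sum_comp, Fintype.sum_prod_type]
    simp [ih, Fin.consEquiv, walkProd, Finset.mul_sum]

theorem trace_pow_eq_sum_cycleProd {ι : Type*} [Fintype ι] [DecidableEq ι]
    (A : Matrix ι ι ℂ) {k : ℕ} (hk : k ≠ 0) :
    (A ^ k).trace = ∑ w : Fin k → ι, cycleProd A (List.ofFn w) := by
  obtain ⟨k, rfl⟩ := Nat.exists_eq_succ_of_ne_zero hk
  rw [← (Fin.consEquiv fun _ => ι).sum_comp, Fintype.sum_prod_type, Matrix.trace]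
  simp [pow_succ_apply_eq_sum_walkProd, Fin.consEquiv, cycleProd]

/-- Adding a letter to a word of length `k` multiplies the weight by at most `k + 1`: at most `k`
choices repeat a letter, and the new ones have total weight at most `1`. -/
theorem sum_inv_card_pow_card_toFinset_le (ι : Type*) [Fintype ι] [DecidableEq ι] (k : ℕ) :
    ∑ w : Fin k → ι, ((Fintype.card ι : ℝ)⁻¹) ^ (List.ofFn w).toFinset.card ≤ k ! := by
  induction k with
  | zero => simp
  | succ k ih =>
    rw [← (Fin.consEquiv fun _ => ι).sum_comp, Fintype.sum_prod_type, Finset.sum_comm,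
      Nat.factorial_succ]
    push_cast
    refine le_trans ?_ (mul_le_mul_of_nonneg_left ih (by positivity))
    rw [Finset.mul_sum]
    refine Finset.sum_le_sum fun w _ => ?_
    simp only [Fin.consEquiv, Equiv.coe_fn_mk, List.ofFn_cons, List.toFinset_cons]
    have hA : ((List.ofFn w).toFinset.card : ℝ) ≤ k := by
      exact_mod_cast (List.toFinset_card_le _).trans (by simp)
    generalize (List.ofFn w).toFinset = A at hA ⊢
    set x : ℝ := (Fintype.card ι : ℝ)⁻¹ with hx
    have hx0 : 0 ≤ x := by positivity
    have hx1 : (Fintype.card ι : ℝ) * x ≤ 1 := mul_inv_le_one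
    have h1 : ∀ i ∈ A, x ^ (insert i A).card = x ^ A.card := fun i hi => by
      rw [Finset.insert_eq_of_mem hi]
    have h2 : ∀ i ∈ Aᶜ, x ^ (insert i A).card = x ^ A.card * x := fun i hi => by
      rw [Finset.card_insert_of_notMem (by simpa using hi), pow_succ]
    rw [← Finset.sum_add_sum_compl A, Finset.sum_congr rfl h1, Finset.sum_congr rfl h2,
      Finset.sum_const, Finset.sum_const, nsmul_eq_mul, nsmul_eq_mul]
    have h3 : (Aᶜ.card : ℝ) * x ≤ 1 := by
      refine le_trans ?_ hx1
      gcongr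
      exact Finset.card_le_univ _
    have h4 : 0 ≤ x ^ A.card := by positivity
    nlinarith

theorem opNorm_sq_le_sum {n : ℕ} (A : Matrix (Fin n) (Fin n) ℂ) :
    matrixOpNorm A ^ 2 ≤ ∑ i, ∑ j, ‖A i j‖ ^ 2 := by
  have h0 : 0 ≤ ∑ i, ∑ j, ‖A i j‖ ^ 2 := by positivity
  rw [matrixOpNorm, ← Real.le_sqrt (norm_nonneg _) h0]
  refine ContinuousLinearMap.opNorm_le_bound _ (Real.sqrt_nonneg _) fun x => ?_
  refine abs_le_of_sq_le_sq' ?_ (by positivity) |>.2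
  rw [mul_pow, Real.sq_sqrt h0, EuclideanSpace.norm_sq_eq, EuclideanSpace.norm_sq_eq,
    Finset.sum_mul]
  refine Finset.sum_le_sum fun i _ => ?_
  rw [Matrix.ofLp_toEuclideanCLM, Matrix.mulVec, dotProduct]
  calc _ ≤ (∑ j, ‖A i j‖ * ‖x j‖) ^ 2 := by
        gcongr
        exact (norm_sum_le _ _).trans_eq (by simp)
    _ ≤ _ := Finset.sum_mul_sq_le_sq_mul_sq _ _ _

/-- The operator norm of a Hermitian matrix is bounded by traces of its powers. -/
theorem opNorm_pow_le_re_trace {n : ℕ} {A : Matrix (Fin n) (Fin n) ℂ} (hA : A.IsHermitian)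
    (r : ℕ) : matrixOpNorm A ^ (2 * 2 ^ r) ≤ ((A ^ (2 * 2 ^ r)).trace).re := by
  have hsa : IsSelfAdjoint (Matrix.toEuclideanCLM (n := Fin n) (𝕜 := ℂ) A) :=
    IsSelfAdjoint.map (hA : IsSelfAdjoint A) _
  -- The C*-identity, iterated `r` times; this is why exponents are powers of two.
  have h1 : matrixOpNorm A ^ 2 ^ r = matrixOpNorm (A ^ 2 ^ r) := by
    rw [matrixOpNorm, matrixOpNorm, map_pow, hsa.norm_pow_two_pow]
  rw [mul_comm, pow_mul, h1, pow_mul]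
  refine (opNorm_sq_le_sum _).trans ?_
  have hB : (A ^ 2 ^ r).IsHermitian := hA.pow _
  generalize A ^ 2 ^ r = B at hB
  have h2 : (B ^ 2).trace = ((∑ i, ∑ j, ‖B i j‖ ^ 2 : ℝ) : ℂ) := by
    rw [pow_two]
    simp only [Matrix.trace, Matrix.diag, Matrix.mul_apply]
    push_cast
    refine Finset.sum_congr rfl fun i _ => Finset.sum_congr rfl fun j _ => ?_
    rw [← hB.apply j i, ← Complex.mul_conj']
    rfl
  rw [h2, Complex.ofReal_re]

/-! ### The trace moment -/

/-- Bound for a single cyclic word in the expansion of the trace moment. -/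
theorem norm_sum_perm_cycleProd_offDiag_le {D : Type*} [Fintype D] [DecidableEq D]
    {g : D → D → ℂ} {N p n K : ℕ} {M : ℝ} (hN : 1 ≤ N) (hn : 1 ≤ n) (hnp : n ≤ p)
    (hcard : Fintype.card D = N * p) (hM : 1 ≤ M)
    (h1 : ∀ a, g a a = 1) (hle : ∀ a b, ‖g a b‖ ≤ 1)
    (hoff : ∀ a b, a ≠ b → ‖g a b‖ ≤ M / √(p : ℝ))
    (hmul : ∀ a b, ∑ y, g a y * g y b = N * g a b) (S : Fin n ↪ D)
    (w : Fin (2 * K) → Fin n) :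
    ‖∑ σ : Equiv.Perm D,
        cycleProd (offDiag fun i j => g (σ (S i)) (σ (S j))) (List.ofFn w)‖ ≤
      Fintype.card (Equiv.Perm D) * (M ^ (2 * K) * ((2 * K)! : ℝ) ^ 2) *
        (n * ((n : ℝ) / p) ^ K) * ((n : ℝ)⁻¹) ^ (List.ofFn w).toFinset.card := by
  have hp : 1 ≤ p := hn.trans hnp
  have hp0 : (0 : ℝ) < p := by exact_mod_cast hp
  have hn0 : (0 : ℝ) < n := by exact_mod_cast hn
  have hn1 : (1 : ℝ) ≤ n := by exact_mod_cast hn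
  have hnp' : (n : ℝ) ≤ p := by exact_mod_cast hnp
  have hM0 : 0 ≤ M := by linarith
  set l := List.ofFn w with hl
  have hlen : l.length = 2 * K := by simp [hl]
  set v := l.toFinset.card with hv
  have hvL : v ≤ 2 * K := (List.toFinset_card_le l).trans hlen.le
  have hfac : (1 : ℝ) ≤ ((2 * K)! : ℝ) ^ 2 :=
    one_le_pow₀ (by exact_mod_cast Nat.one_le_iff_ne_zero.mpr (Nat.factorial_ne_zero _))
  set P : ℝ := ((Fintype.card (Equiv.Perm D) : ℕ) : ℝ)
  set E := ∑ σ : Equiv.Perm D, cycleProd (offDiag fun i j => g (σ (S i)) (σ (S j))) l with hE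
  have key : ‖E‖ * ((p : ℝ) ^ K * (n : ℝ) ^ v) ≤
      P * (M ^ (2 * K) * ((2 * K)! : ℝ) ^ 2) * (n : ℝ) ^ (K + 1) := by
    -- For `v ≤ K + 1` coherence alone gives `p ^ (-K)`, and `n ^ v ≤ n ^ (K + 1)`. For larger `v`
    -- the averaged bound is needed: `n ^ v * p ^ (1 - v) = n * (n / p) ^ (v - 1) ≤ n * (n / p) ^
    -- K`.
    rcases le_or_gt v (K + 1) with hvK | hvK
    · have hA : ‖E‖ ≤ P * (M / √(p : ℝ)) ^ (2 * K) := by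
        refine norm_sum_perm_le _ fun σ => ?_
        rw [← hlen]
        refine norm_cycleProd_le (norm_offDiag_le (by positivity) fun x y hxy => ?_) l
        exact hoff _ _ (σ.injective.ne (S.injective.ne hxy))
      calc _ ≤ P * (M / √(p : ℝ)) ^ (2 * K) * ((p : ℝ) ^ K * (n : ℝ) ^ (K + 1)) := by
            gcongr
        _ = P * (M ^ (2 * K) * 1) * (n : ℝ) ^ (K + 1) := by
            rw [div_pow, pow_mul (√(p : ℝ)), Real.sq_sqrt hp0.le]
            field_simp
        _ ≤ _ := by gcongr
    · rcases cycleProd_offDiag_dichotomy l with h | h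
      swap
      · have : E = 0 := Finset.sum_eq_zero fun σ _ => h _
        rw [this]; simp; positivity
      · have hE' : E = ∑ σ : Equiv.Perm D, cycleProd g ((l.map S).map σ) := by
          refine Finset.sum_congr rfl fun σ _ => ?_
          rw [h, cycleProd_map, cycleProd_map]
        have hcardS : (l.map S).toFinset.card = v := by
          rw [hv, ← Finset.card_map S]
          congr 1
          ext x; simp
        have hB := norm_sum_perm_cycleProd_le hN hp hcard hM h1 hle hoff hmul (l.map S)
        rw [← hE', hcardS, List.length_map, hlen] at hB
        obtain ⟨r, hr⟩ := Nat.exists_eq_add_of_le hvK.le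
        have hvfac : (v ! : ℝ) ≤ ((2 * K)! : ℝ) := by exact_mod_cast Nat.factorial_le hvL
        have hB' : ‖E‖ * ((p : ℝ) ^ K * (p : ℝ) ^ r) ≤
            P * (M ^ (2 * K) * ((2 * K)! : ℝ) ^ 2) := by
          refine le_of_mul_le_mul_right ?_ hp0
          calc _ = ‖E‖ * (p : ℝ) ^ v := by rw [hr]; ring
            _ ≤ _ := hB
            _ ≤ P * (M ^ (2 * K) * ((2 * K)! : ℝ) ^ 2 * p) := by gcongr
            _ = _ := by ring
        calc _ = ‖E‖ * ((p : ℝ) ^ K * (n : ℝ) ^ r) * (n : ℝ) ^ (K + 1) := by rw [hr]; ring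
          _ ≤ ‖E‖ * ((p : ℝ) ^ K * (p : ℝ) ^ r) * (n : ℝ) ^ (K + 1) := by gcongr
          _ ≤ _ := by gcongr
  rw [← le_div_iff₀ (by positivity)] at key
  refine key.trans_eq ?_
  rw [inv_pow, div_pow]
  field_simp
  ring

theorem sum_embedding_trans_perm {n : ℕ} {D β : Type*} [Fintype D] [DecidableEq D]
    [AddCommMonoid β] (f : (Fin n ↪ D) → β) (σ : Equiv.Perm D) :
    ∑ S : Fin n ↪ D, f (S.trans σ.toEmbedding) = ∑ S : Fin n ↪ D, f S :=
  Fintype.sum_equiv ((Equiv.refl _).embeddingCongr σ) _ _ fun S => by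
    congr 1

/-- Trace moment bound for the off-diagonal part of the Gram matrix of random atoms. -/
theorem norm_sum_embedding_trace_le {D : Type*} [Fintype D] [DecidableEq D]
    {g : D → D → ℂ} {N p n K : ℕ} {M : ℝ} (hN : 1 ≤ N) (hn : 1 ≤ n) (hnp : n ≤ p) (hK : K ≠ 0)
    (hcard : Fintype.card D = N * p) (hM : 1 ≤ M)
    (h1 : ∀ a, g a a = 1) (hle : ∀ a b, ‖g a b‖ ≤ 1)
    (hoff : ∀ a b, a ≠ b → ‖g a b‖ ≤ M / √(p : ℝ))
    (hmul : ∀ a b, ∑ y, g a y * g y b = N * g a b) :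
    ‖∑ S : Fin n ↪ D, ((Matrix.of (offDiag fun i j => g (S i) (S j))) ^ (2 * K)).trace‖ ≤
      Fintype.card (Fin n ↪ D) *
        (M ^ (2 * K) * ((2 * K)! : ℝ) ^ 3 * (n * ((n : ℝ) / p) ^ K)) := by
  set T : (Fin n ↪ D) → ℂ :=
    fun S => ((Matrix.of (offDiag fun i j => g (S i) (S j))) ^ (2 * K)).trace with hT
  have hM0 : 0 ≤ M := by linarith
  have hP : (0 : ℝ) < ((Fintype.card (Equiv.Perm D) : ℕ) : ℝ) := by
    exact_mod_cast Fintype.card_pos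
  have havg : ((Fintype.card (Equiv.Perm D) : ℕ) : ℂ) * ∑ S, T S =
      ∑ S : Fin n ↪ D, ∑ w : Fin (2 * K) → Fin n, ∑ σ : Equiv.Perm D,
        cycleProd (offDiag fun i j => g (σ (S i)) (σ (S j))) (List.ofFn w) := by
    calc _ = ∑ σ : Equiv.Perm D, ∑ S : Fin n ↪ D, T (S.trans σ.toEmbedding) := by
          simp_rw [sum_embedding_trans_perm T]
          rw [Finset.sum_const, nsmul_eq_mul, Finset.card_univ]
      _ = _ := by
          rw [Finset.sum_comm]
          refine Finset.sum_congr rfl fun S _ => ?_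
          rw [Finset.sum_comm]
          refine Finset.sum_congr rfl fun σ _ => ?_
          exact trace_pow_eq_sum_cycleProd _ (by omega)
  refine le_of_mul_le_mul_left ?_ hP
  calc _ = ‖((Fintype.card (Equiv.Perm D) : ℕ) : ℂ) * ∑ S, T S‖ := by simp
    _ ≤ ∑ S : Fin n ↪ D, ∑ w : Fin (2 * K) → Fin n,
        Fintype.card (Equiv.Perm D) * (M ^ (2 * K) * ((2 * K)! : ℝ) ^ 2) *
        (n * ((n : ℝ) / p) ^ K) * ((n : ℝ)⁻¹) ^ (List.ofFn w).toFinset.card := by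
        rw [havg]
        refine (norm_sum_le _ _).trans (Finset.sum_le_sum fun S _ => ?_)
        refine (norm_sum_le _ _).trans (Finset.sum_le_sum fun w _ => ?_)
        exact norm_sum_perm_cycleProd_offDiag_le hN hn hnp hcard hM h1 hle hoff hmul S w
    _ ≤ ∑ S : Fin n ↪ D, Fintype.card (Equiv.Perm D) * (M ^ (2 * K) * ((2 * K)! : ℝ) ^ 2) *
        (n * ((n : ℝ) / p) ^ K) * (2 * K)! := by
        refine Finset.sum_le_sum fun S _ => ?_
        rw [← Finset.mul_sum]
        gcongr
        simpa using sum_inv_card_pow_card_toFinset_le (Fin n) (2 * K)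
    _ = _ := by
        rw [Finset.sum_const, nsmul_eq_mul, Finset.card_univ]
        ring

/-! ### Coherent dictionaries -/

section Dictionary

variable {H X : Type*} [NormedAddCommGroup H] [InnerProductSpace ℂ H] {p : ℕ}
  (B : X → OrthonormalBasis (Fin p) ℂ H)

theorem sum_inner_mul_inner_dictionary [Fintype X] (a b : H) :
    ∑ y : X × Fin p, inner ℂ a (B y.1 y.2) * inner ℂ (B y.1 y.2) b =
      (Fintype.card X : ℂ) * inner ℂ a b := by
  rw [Fintype.sum_prod_type]
  simp [OrthonormalBasis.sum_inner_mul_inner]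

theorem IsCoherentFamily.norm_inner_le {B : X → OrthonormalBasis (Fin p) ℂ H} {μ : ℝ}
    (hμ : 0 ≤ μ) (hB : IsCoherentFamily μ B) {a b : X × Fin p} (hab : a ≠ b) :
    ‖inner ℂ (B a.1 a.2) (B b.1 b.2)‖ ≤ μ / √(p : ℝ) := by
  by_cases h : a.1 = b.1
  · have h2 : a.2 ≠ b.2 := fun h2 => hab (Prod.ext h h2)
    rw [h, (B b.1).orthonormal.2 h2, norm_zero]
    positivity
  · exact hB _ _ h _ _

theorem gramMatrix_sub_one_eq {n : ℕ} (S : Fin n ↪ X × Fin p) :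
    gramMatrix B S - 1 =
      Matrix.of (offDiag fun i j => inner ℂ (B (S i).1 (S i).2) (B (S j).1 (S j).2)) := by
  ext i j
  by_cases h : i = j
  · subst h
    simp [gramMatrix, Matrix.gram_apply, offDiag]
  · simp [gramMatrix, Matrix.gram_apply, offDiag, h]

theorem sum_opNorm_gramMatrix_sub_one_pow_le [Fintype X] [Nonempty X] [DecidableEq X] {μ : ℝ}
    (hμ : 0 ≤ μ) (hB : IsCoherentFamily μ B) {n : ℕ} (hn : 1 ≤ n) (hnp : n ≤ p) (r : ℕ) :
    ∑ S : Fin n ↪ X × Fin p, matrixOpNorm (gramMatrix B S - 1) ^ (2 * 2 ^ r) ≤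
      Fintype.card (Fin n ↪ X × Fin p) *
        ((max 1 μ) ^ (2 * 2 ^ r) * ((2 * 2 ^ r)! : ℝ) ^ 3 * (n * ((n : ℝ) / p) ^ 2 ^ r)) := by
  set g : X × Fin p → X × Fin p → ℂ := fun a b => inner ℂ (B a.1 a.2) (B b.1 b.2) with hg
  have h1 : ∀ a, g a a = 1 := fun a => by simp [hg]
  have hle : ∀ a b, ‖g a b‖ ≤ 1 := fun a b =>
    (norm_inner_le_norm _ _).trans (by simp)
  have hoff : ∀ a b, a ≠ b → ‖g a b‖ ≤ max 1 μ / √(p : ℝ) := fun a b hab =>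
    (hB.norm_inner_le hμ hab).trans (by gcongr; exact le_max_right _ _)
  have hmul : ∀ a b, ∑ y, g a y * g y b = (Fintype.card X : ℂ) * g a b := fun a b =>
    sum_inner_mul_inner_dictionary B _ _
  refine le_trans ?_ (norm_sum_embedding_trace_le (K := 2 ^ r) (Fintype.card_pos (α := X)) hn hnp
    (by positivity) (by simp) (le_max_left 1 μ) h1 hle hoff hmul)
  refine le_trans ?_ (Complex.re_le_norm _)
  rw [Complex.re_sum]
  refine Finset.sum_le_sum fun S _ => ?_
  have hherm : (gramMatrix B S - 1).IsHermitian :=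
    (Matrix.isHermitian_gram ℂ _).sub Matrix.isHermitian_one
  refine (opNorm_pow_le_re_trace hherm r).trans_eq ?_
  rw [gramMatrix_sub_one_eq]

end Dictionary

/-! ### Markov's inequality and conclusion -/

/-- Markov's inequality for the uniform distribution. -/
theorem uniformProb_mul_le {Ω : Type*} [Fintype Ω] {f : Ω → ℝ} (hf : ∀ ω, 0 ≤ f ω) {s Q : ℝ}
    (hs : 0 ≤ s) (hQ : 0 ≤ Q) (m : ℕ) (h : ∑ ω, f ω ^ m ≤ Fintype.card Ω * Q) :
    uniformProb {ω | s ≤ f ω} * s ^ m ≤ Q := by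
  classical
  rw [uniformProb, div_mul_eq_mul_div]
  refine div_le_of_le_mul₀ (by positivity) hQ ?_
  rw [Nat.card_eq_fintype_card, mul_comm Q]
  refine le_trans ?_ h
  rw [Set.ncard_eq_toFinset_card', ← nsmul_eq_mul]
  refine (Finset.card_nsmul_le_sum _ _ (s ^ m) fun ω hω => ?_).trans
    (Finset.sum_le_univ_sum_of_nonneg fun ω => pow_nonneg (hf ω) m)
  rw [Set.mem_toFinset] at hω
  exact pow_le_pow_left₀ hs hω m

theorem rpow_moment_le {x e : ℝ} (hx0 : 0 < x) (hx1 : x ≤ 1) (he : 0 ≤ e) {k K : ℕ}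
    (hkK : k ≤ K) :
    x ^ K / (x ^ (1 / (2 + e))) ^ (2 * K) ≤ x ^ (e * (k : ℝ) / (2 + e)) := by
  rw [← Real.rpow_natCast, ← Real.rpow_natCast (x ^ (1 / (2 + e))), ← Real.rpow_mul hx0.le,
    ← Real.rpow_sub hx0]
  refine Real.rpow_le_rpow_of_exponent_ge hx0 hx1 ?_
  have hkK' : (k : ℝ) ≤ K := by exact_mod_cast hkK
  have h : (K : ℝ) - 1 / (2 + e) * ((2 * K : ℕ) : ℝ) = e * K / (2 + e) := by
    push_cast
    field_simp
    ring
  rw [h]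
  gcongr

theorem theorem4 (μ : ℝ) (hμ : 0 < μ) (k : ℕ) (hk : Even k) :
    ∃ C : ℝ, 0 < C ∧
      ∀ (ε : ℝ), 0 < ε → ε < 1 → ∀ (e : ℝ), 0 ≤ e →
      ∀ (p n : ℕ), 1 ≤ p → n = ⌊(p : ℝ) ^ (1 - ε)⌋₊ →
      ∀ (H : Type*) [NormedAddCommGroup H] [InnerProductSpace ℂ H]
        (X : Type*) [Finite X] [Nonempty X]
        (B : X → OrthonormalBasis (Fin p) ℂ H), IsCoherentFamily μ B →
        uniformProb {S : Fin n ↪ X × Fin p |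
            ((n : ℝ) / (p : ℝ)) ^ (1 / (2 + e)) ≤ matrixOpNorm (gramMatrix B S - 1)}
          ≤ C * (((n : ℝ) / (p : ℝ)) ^ (e * (k : ℝ) / (2 + e)) * (n : ℝ)) := by
  -- The constant of the moment of order `2 * 2 ^ k`. As `k < 2 ^ k` and `n / p ≤ 1`, the exponent
  -- `e * 2 ^ k / (2 + e)` that Markov's inequality yields can be lowered to `e * k / (2 + e)`.
  refine ⟨(max 1 μ) ^ (2 * 2 ^ k) * ((2 * 2 ^ k)! : ℝ) ^ 3, by positivity, ?_⟩
  intro ε hε hε1 e he p n hp hn H _ _ X _ _ B hB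
  classical
  have := Fintype.ofFinite X
  have hp1 : (1 : ℝ) ≤ p := by exact_mod_cast hp
  have hn1 : 1 ≤ n := by
    rw [hn, Nat.one_le_floor_iff]
    exact Real.one_le_rpow hp1 (by linarith)
  have hnp : n ≤ p := by
    rw [hn]
    refine Nat.floor_le_of_le ?_
    simpa using Real.rpow_le_rpow_of_exponent_le hp1 (by linarith : 1 - ε ≤ 1)
  have hn0 : (0 : ℝ) < n := by exact_mod_cast hn1
  have hx0 : 0 < (n : ℝ) / p := by positivity
  have hx1 : (n : ℝ) / p ≤ 1 := by
    rw [div_le_one (by positivity)]; exact_mod_cast hnp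
  have hmain := uniformProb_mul_le
    (f := fun S : Fin n ↪ X × Fin p => matrixOpNorm (gramMatrix B S - 1))
    (fun S => norm_nonneg _) (s := ((n : ℝ) / p) ^ (1 / (2 + e))) (by positivity) (by positivity)
    (2 * 2 ^ k) (sum_opNorm_gramMatrix_sub_one_pow_le B hμ.le hB hn1 hnp k)
  rw [← le_div_iff₀ (by positivity)] at hmain
  refine hmain.trans ?_
  rw [mul_div_assoc, mul_div_assoc, mul_comm (n : ℝ)]
  gcongr
  exact rpow_moment_le hx0 hx1 he Nat.lt_two_pow_self.le
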